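/- Throughout, a graph is a graph in the sense of Serre: a set $V$ of vertices, a set $E$ of oriented edges, origin and terminus maps $o,t\colon E\to V$, and a map $E\to E$, $e\mapsto\bar e$, with $\bar{\bar e}=e$, $\bar e\ne e$ and $o(e)=t(\bar e)$ for every edge $e$. A tree is a non-empty connected graph without circuits, a circuit being a closed path $(e_1,\dots,e_r)$ with $r\ge 1$ such that $e_i\neq\bar e_{i+1}$ for $1\le i<r$. A totally disconnected locally compact (t.d.l.c.) group $G$ is compactly generated if there are a compact open subgroup $K\le G$ and a finite symmetric set $S\subset G\setminus K$ such that $S\cup K$ generates $G$ algebraically. **Proposition 4.1.** Let $G$ be a compactly generated t.d.l.c. group. Suppose that $G$ acts by graph automorphisms on a tree $\mathcal T$ discretely, i.e. such that the stabilizers of vertices and edges are open subgroups of $G$, and that (i) $G$ acts without edge inversions, i.e. $g\cdot e\neq\bar e$ for all $g\in G$ and all edges $e$ of $\mathcal T$; (ii) the quotient graph $G\backslash\mathcal T$ is finite, i.e. has finitely many vertices and edges; (iii) for every edge $e$ of $\mathcal T$ the stabilizer $G_e$ is a compact open subgroup of $G$. Then for every vertex $v$ of $\mathcal T$ the stabilizer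 $G_v$, with the subspace topology, is compactly generated. -/

import Mathlib

/-- A graph in the sense of Serre: vertices `V`, oriented edges `E`, origin and terminus maps, and
a fixed-point-free inversion `e ↦ ē` of the oriented edges exchanging origin and terminus.
Loops and multiple edges are allowed. -/
structure SerreGraph (V : Type*) (E : Type*) where
  origin : E → V
  terminus : E → V
  inv : E → E
  inv_inv : ∀ e, inv (inv e) = e
  inv_ne : ∀ e, inv e ≠ e
  origin_eq : ∀ e, origin e = terminus (inv e)

namespace SerreGraph

variable {V E : Type*}

/-- The list of edges `p` is a path from `v` to `w`: its first edge starts at `v`, its last edge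
ends at `w`, and each edge ends where the next one starts. The empty list is the trivial path
from a vertex to itself. -/
def IsPath (Γ : SerreGraph V E) : List E → V → V → Prop
  | [], v, w => v = w
  | e :: p, v, w => Γ.origin e = v ∧ Γ.IsPath p (Γ.terminus e) w

/-- A list of edges is reduced if no edge is the inverse of the edge that follows it. -/
def IsReduced (Γ : SerreGraph V E) (p : List E) : Prop :=
  p.IsChain (fun e f => e ≠ Γ.inv f)

/-- A circuit is a reduced closed path of positive length. -/
def IsCircuit (Γ : SerreGraph V E) (p : List E) : Prop :=
  p ≠ [] ∧ Γ.IsReduced p ∧ ∃ v, Γ.IsPath p v v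

/-- Any two vertices are joined by a path. -/
def IsConnected (Γ : SerreGraph V E) : Prop :=
  ∀ v w, ∃ p, Γ.IsPath p v w

/-- A tree is a connected non-empty graph without circuits. -/
structure IsTree (Γ : SerreGraph V E) : Prop where
  nonempty : Nonempty V
  connected : Γ.IsConnected
  no_circuit : ∀ p, ¬ Γ.IsCircuit p

/-- A graph is finite if it has finitely many vertices and finitely many edges. -/
def IsFinite (_Γ : SerreGraph V E) : Prop := Finite V ∧ Finite E

/-- The given actions of `G` on vertices and on edges form an action on the graph, i.e. every
group element acts by a graph automorphism. -/
structure IsAction (G : Type*) [Group G] [MulAction G V] [MulAction G E]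
    (Γ : SerreGraph V E) : Prop where
  origin_smul : ∀ (g : G) (e : E), Γ.origin (g • e) = g • Γ.origin e
  terminus_smul : ∀ (g : G) (e : E), Γ.terminus (g • e) = g • Γ.terminus e
  inv_smul : ∀ (g : G) (e : E), Γ.inv (g • e) = g • Γ.inv e

/-- The action has no edge inversions: no group element maps an edge to its inverse. -/
def WithoutInversions (G : Type*) [Group G] [MulAction G E] (Γ : SerreGraph V E) : Prop :=
  ∀ (g : G) (e : E), g • e ≠ Γ.inv e

/-- The action is discrete: all stabilizers of vertices and of edges are open. -/
def ActsDiscretely (G : Type*) [Group G] [TopologicalSpace G] [MulAction G V] [MulAction G E]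
    (_Γ : SerreGraph V E) : Prop :=
  (∀ v : V, IsOpen (MulAction.stabilizer G v : Set G)) ∧
    ∀ e : E, IsOpen (MulAction.stabilizer G e : Set G)

/-- The quotient graph `G \ Γ` of a graph by an action without edge inversions: its vertices and
edges are the `G`-orbits of vertices and edges of `Γ`, with the induced structure maps. -/
def quotient (G : Type*) [Group G] [MulAction G V] [MulAction G E] (Γ : SerreGraph V E)
    (hact : Γ.IsAction G) (hinv : Γ.WithoutInversions G) :
    SerreGraph (MulAction.orbitRel.Quotient G V) (MulAction.orbitRel.Quotient G E) where
  origin := Quotient.map Γ.origin (by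
    rintro _ e ⟨g, rfl⟩
    exact ⟨g, (hact.origin_smul g e).symm⟩)
  terminus := Quotient.map Γ.terminus (by
    rintro _ e ⟨g, rfl⟩
    exact ⟨g, (hact.terminus_smul g e).symm⟩)
  inv := Quotient.map Γ.inv (by
    rintro _ e ⟨g, rfl⟩
    exact ⟨g, (hact.inv_smul g e).symm⟩)
  inv_inv := by
    rintro ⟨e⟩
    exact congrArg (Quotient.mk _) (Γ.inv_inv e)
  inv_ne := by
    rintro ⟨e⟩ h
    obtain ⟨g, hg⟩ := Quotient.exact h
    exact hinv g e hg
  origin_eq := by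
    rintro ⟨e⟩
    exact congrArg (Quotient.mk _) (Γ.origin_eq e)

end SerreGraph

/-- A (totally disconnected locally compact) topological group is compactly generated if it is
algebraically generated by `S ∪ K` for some compact open subgroup `K` and some finite symmetric
set `S` disjoint from `K`. -/
def IsCompactlyGeneratedGroup (G : Type*) [Group G] [TopologicalSpace G] : Prop :=
  ∃ (K : Subgroup G) (S : Set G), IsCompact (K : Set G) ∧ IsOpen (K : Set G) ∧
    S.Finite ∧ S⁻¹ = S ∧ Disjoint S (K : Set G) ∧ Subgroup.closure (S ∪ (K : Set G)) = ⊤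

/-! Let `v` be the origin of an edge `e₀`. Let `H ≤ G_v` be generated by the stabilizers of the
finitely many edge-orbit representatives at `v` and by finitely many elements read off from paths
joining `e₀` to its translates under the compact generating set. Split each vertex `g • v` into
pieces indexed by the cosets of `H` in `g G_v`. The choice of `H` makes those paths survive the
splitting, so by equivariance all of `G • e₀` stays connected to `e₀`. In a tree, distinct pieces of
one vertex cannot be joined (`IsWalk.rel_of_origin_eq`), so there is only one piece and `H = G_v`.
-/

namespace SerreGraph

/-! ### Walks in graphs with split vertices -/

variable {V E : Type*}

/-- `Γ.IsWalk R p e f`: the list of edges `p` leads from `e` to `f`, where two edges may follow one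
another if the inverse of the first and the second are related by `R`. If `R` is an equivalence
relation refining equality of origins, these are the paths between the origins of `e` and `f`
in the graph obtained from `Γ` by splitting each vertex into the `R`-classes of edges issuing
from it. -/
def IsWalk (Γ : SerreGraph V E) (R : E → E → Prop) : List E → E → E → Prop
  | [], e, f => R e f
  | x :: p, e, f => R e x ∧ Γ.IsWalk R p (Γ.inv x) f

namespace IsWalk

variable {Γ : SerreGraph V E} {R : E → E → Prop}

theorem mono {R' : E → E → Prop} (h : ∀ e f, R e f → R' e f) {p : List E} {e f : E}
    (hp : Γ.IsWalk R p e f) : Γ.IsWalk R' p e f := by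
  induction p generalizing e with
  | nil => exact h _ _ hp
  | cons x p ih => exact ⟨h _ _ hp.1, ih hp.2⟩

theorem cons_left (hR : Equivalence R) {p : List E} {e e' f : E} (h : R e e')
    (hp : Γ.IsWalk R p e' f) : Γ.IsWalk R p e f := by
  cases p with
  | nil => exact hR.trans h hp
  | cons x p => exact ⟨hR.trans h hp.1, hp.2⟩

theorem append (hR : Equivalence R) {p q : List E} {e f g : E} (hp : Γ.IsWalk R p e f)
    (hq : Γ.IsWalk R q f g) : Γ.IsWalk R (p ++ q) e g := by
  induction p generalizing e with
  | nil => exact hq.cons_left hR hp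
  | cons x p ih => exact ⟨hp.1, ih hp.2⟩

theorem exists_symm (hR : Equivalence R) {p : List E} {e f : E} (hp : Γ.IsWalk R p e f) :
    ∃ q, Γ.IsWalk R q f e := by
  induction p generalizing e with
  | nil => exact ⟨[], hR.symm hp⟩
  | cons x p ih =>
    obtain ⟨q, hq⟩ := ih hp.2
    have hx : Γ.IsWalk R [Γ.inv x] (Γ.inv x) e :=
      ⟨hR.refl _, by simpa only [IsWalk, Γ.inv_inv] using hR.symm hp.1⟩
    exact ⟨_, hq.append hR hx⟩

theorem smul {G : Type*} [Group G] [MulAction G V] [MulAction G E] (hact : Γ.IsAction G)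
    (hR : ∀ (g : G) e f, R e f → R (g • e) (g • f)) (g : G) {p : List E} {e f : E}
    (hp : Γ.IsWalk R p e f) : Γ.IsWalk R (p.map (g • ·)) (g • e) (g • f) := by
  induction p generalizing e with
  | nil => exact hR g _ _ hp
  | cons x p ih =>
    refine ⟨hR g _ _ hp.1, ?_⟩
    rw [hact.inv_smul]
    exact ih hp.2

theorem isPath (hR : ∀ e f, R e f → Γ.origin e = Γ.origin f) {p : List E} {e f : E}
    (hp : Γ.IsWalk R p e f) : Γ.IsPath p (Γ.origin e) (Γ.origin f) := by
  induction p generalizing e with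
  | nil => exact hR _ _ hp
  | cons x p ih =>
    refine ⟨(hR _ _ hp.1).symm, ?_⟩
    have h := ih hp.2
    rwa [Γ.origin_eq (Γ.inv x), Γ.inv_inv] at h

/-- Every walk can be replaced by a reduced one. -/
theorem exists_isReduced (hR : Equivalence R) {p : List E} {e f : E} (hp : Γ.IsWalk R p e f) :
    ∃ q, Γ.IsReduced q ∧ Γ.IsWalk R q e f := by
  induction p generalizing e with
  | nil => exact ⟨[], List.isChain_nil, hp⟩
  | cons x p ih =>
    obtain ⟨q, hq, hw⟩ := ih hp.2
    cases q with
    | nil => exact ⟨[x], List.isChain_singleton x, hp.1, hw⟩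
    | cons y q =>
      by_cases hxy : x = Γ.inv y
      -- Backtracking cancels: after `y` the walk resumes at `Γ.inv y = x`, which is related to `e`.
      · refine ⟨q, hq.tail, ?_⟩
        exact hw.2.cons_left hR (hxy ▸ hp.1)
      · exact ⟨x :: y :: q, List.isChain_cons_cons.2 ⟨hxy, hq⟩, hp.1, hw⟩

/-- In a graph without circuits, edges with the same origin joined by a walk are related. -/
theorem rel_of_origin_eq (hΓ : ∀ p, ¬ Γ.IsCircuit p) (hR : Equivalence R)
    (hR' : ∀ e f, R e f → Γ.origin e = Γ.origin f) {p : List E} {e f : E}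
    (hp : Γ.IsWalk R p e f) (hef : Γ.origin e = Γ.origin f) : R e f := by
  obtain ⟨q, hq, hw⟩ := hp.exists_isReduced hR
  cases q with
  | nil => exact hw
  | cons x q =>
    have h := hw.isPath hR'
    rw [← hef] at h
    exact absurd ⟨List.cons_ne_nil _ _, hq, _, h⟩ (hΓ (x :: q))

end IsWalk

/-- A path is a walk for some finite relation refining equality of origins. -/
theorem IsPath.exists_finite_isWalk {Γ : SerreGraph V E} {p : List E} {e f : E}
    (hp : Γ.IsPath p (Γ.origin e) (Γ.origin f)) :
    ∃ P : Set (E × E), P.Finite ∧ (∀ x ∈ P, Γ.origin x.1 = Γ.origin x.2) ∧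
      Γ.IsWalk (fun a b => (a, b) ∈ P) p e f := by
  induction p generalizing e with
  | nil => exact ⟨{(e, f)}, Set.finite_singleton _, by rintro _ rfl; exact hp, rfl⟩
  | cons x p ih =>
    have h2 : Γ.IsPath p (Γ.origin (Γ.inv x)) (Γ.origin f) := by
      rw [Γ.origin_eq (Γ.inv x), Γ.inv_inv]
      exact hp.2
    obtain ⟨P, hP, hPo, hw⟩ := ih h2
    -- The relation records exactly the turns the path makes at its vertices.
    refine ⟨insert (e, x) P, hP.insert _, ?_, Set.mem_insert _ _,
      hw.mono fun _ _ h => Set.mem_insert_of_mem _ h⟩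
    rintro y (rfl | hy)
    · exact hp.1.symm
    · exact hPo y hy

end SerreGraph

/-! ### Compact generating sets -/

/-- A compact subset of a group meets finitely many cosets of an open subgroup, so it moves a point
with open stabilizer to finitely many points. -/
theorem IsCompact.finite_image_smul_of_isOpen_stabilizer {G X : Type*} [Group G]
    [TopologicalSpace G] [IsTopologicalGroup G] [MulAction G X] {x : X}
    (hx : IsOpen (MulAction.stabilizer G x : Set G)) {C : Set G} (hC : IsCompact C) :
    ((fun g : G => g • x) '' C).Finite := by
  let _ : TopologicalSpace X := ⊥
  have : DiscreteTopology X := ⟨rfl⟩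
  have hcont : Continuous (fun g : G => g • x) := by
    refine continuous_discrete_rng.2 fun y => ?_
    refine isOpen_iff_mem_nhds.2 fun g hg => ?_
    have hopen : IsOpen ((fun h : G => g⁻¹ * h) ⁻¹' (MulAction.stabilizer G x : Set G)) :=
      hx.preimage (continuous_const_mul _)
    refine Filter.mem_of_superset (hopen.mem_nhds (by simp)) fun h hh => ?_
    have hh' : (g⁻¹ * h) • x = x := hh
    rw [mul_smul, inv_smul_eq_iff] at hh'
    exact hh'.trans hg
  exact (hC.image hcont).finite_of_discrete

/-- An open subgroup generated by a compact set and containing a compact open subgroup is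
compactly generated. -/
theorem IsCompactlyGeneratedGroup.of_isCompact_closure_eq {G : Type*} [Group G]
    [TopologicalSpace G] [IsTopologicalGroup G] {L K : Subgroup G} {C : Set G}
    (hC : IsCompact C) (hCL : Subgroup.closure C = L) (hKL : K ≤ L)
    (hKc : IsCompact (K : Set G)) (hKo : IsOpen (K : Set G)) :
    IsCompactlyGeneratedGroup L := by
  have hemb : Topology.IsClosedEmbedding (Subtype.val : L → G) :=
    (Subgroup.isClosed_of_isOpen L (Subgroup.isOpen_mono hKL hKo)).isClosedEmbedding_subtypeVal
  have hst : IsOpen (MulAction.stabilizer G ((1 : G) : G ⧸ K) : Set G) := by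
    rwa [MulAction.stabilizer_quotient]
  have hfin := hC.finite_image_smul_of_isOpen_stabilizer hst
  -- `F` picks one element of `C` from each coset of `K` that meets `C`.
  obtain ⟨F, hFC, hF⟩ := Set.exists_subset_bijOn C (fun g : G => g • ((1 : G) : G ⧸ K))
  have hFfin : F.Finite := .of_finite_image (hF.image_eq ▸ hfin) hF.injOn
  let F' : Set L := Subtype.val ⁻¹' F
  have hF'fin : F'.Finite := hFfin.preimage Subtype.val_injective.injOn
  refine ⟨K.subgroupOf L, (F' ∪ F'⁻¹) \ (K.subgroupOf L : Set L), hemb.isCompact_preimage hKc,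
    hKo.preimage continuous_subtype_val, (hF'fin.union hF'fin.inv).sdiff, ?_,
    Set.disjoint_sdiff_left, ?_⟩
  · ext x
    simp [or_comm]
  · rw [Set.sdiff_union_self]
    have hle : L ≤ (Subgroup.closure ((F' ∪ F'⁻¹) ∪ (K.subgroupOf L : Set L))).map L.subtype := by
      refine hCL.symm.trans_le ((Subgroup.closure_le _).2 fun c hc => ?_)
      obtain ⟨f, hf, hfc⟩ := hF.surjOn (Set.mem_image_of_mem _ hc)
      have hcL : c ∈ L := hCL ▸ Subgroup.subset_closure hc
      have hfL : f ∈ L := hCL ▸ Subgroup.subset_closure (hFC hf)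
      have hfc' : f⁻¹ * c ∈ K := by
        simpa [QuotientGroup.eq] using hfc
      refine ⟨⟨f, hfL⟩ * ⟨f⁻¹ * c, hKL hfc'⟩, mul_mem (Subgroup.subset_closure ?_)
        (Subgroup.subset_closure ?_), by simp⟩
      · exact Or.inl (Or.inl hf)
      · exact Or.inr hfc'
    refine eq_top_iff.2 fun x _ => ?_
    obtain ⟨y, hy, hyx⟩ := hle x.2
    rwa [← Subtype.ext hyx]

/-! ### Vertex stabilizers in trees -/

namespace SerreGraph

variable {V E : Type*}

/-- Representatives of the edge orbits can be chosen to issue from a given vertex `v` whenever the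
orbit contains such an edge. -/
theorem exists_orbit_representatives {G : Type*} [Group G] [MulAction G V] [MulAction G E]
    (Γ : SerreGraph V E) (hact : Γ.IsAction G) (v : V) :
    ∃ (r : MulAction.orbitRel.Quotient G E → E) (a : E → G),
      (∀ e, a e • r (Quotient.mk _ e) = e) ∧
      ∀ e (g : G), Γ.origin e = g • v → Γ.origin (r (Quotient.mk _ e)) = v := by
  have key : ∀ q : MulAction.orbitRel.Quotient G E, ∃ e, Quotient.mk _ e = q ∧
      ∀ e' (g : G), Quotient.mk _ e' = q → Γ.origin e' = g • v → Γ.origin e = v := by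
    intro q
    by_cases h : ∃ e : E, Quotient.mk _ e = q ∧ Γ.origin e = v
    · obtain ⟨e, he, hv⟩ := h
      exact ⟨e, he, fun _ _ _ _ => hv⟩
    · obtain ⟨e, he⟩ := Quotient.exists_rep q
      refine ⟨e, he, fun e' g he' ho => (h ⟨g⁻¹ • e', ?_, ?_⟩).elim⟩
      · rw [← he']
        exact Quotient.sound ⟨g⁻¹, rfl⟩
      · rw [hact.origin_smul, ho, inv_smul_smul]
  choose r hr hro using key
  have hex : ∀ e : E, ∃ g : G, g • r (Quotient.mk _ e) = e := fun e =>
    Quotient.exact (hr (Quotient.mk _ e)).symm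
  choose a ha using hex
  exact ⟨r, a, ha, fun e g h => hro _ e g rfl h⟩

/-- If `G` is generated by a compact set and acts on a tree with finitely many edge orbits and
compact open edge stabilizers, then the stabilizer of a vertex with an incident edge is generated
by a compact set. -/
theorem IsTree.exists_isCompact_closure_eq_stabilizer {G : Type*} [Group G] [TopologicalSpace G]
    [IsTopologicalGroup G] [MulAction G V] [MulAction G E] {T : SerreGraph V E} (hT : T.IsTree)
    (hact : T.IsAction G) [Finite (MulAction.orbitRel.Quotient G E)]
    (hedge : ∀ e : E, IsCompact (MulAction.stabilizer G e : Set G) ∧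
      IsOpen (MulAction.stabilizer G e : Set G))
    {D : Set G} (hD : IsCompact D) (hDG : Subgroup.closure D = ⊤) (e₀ : E) :
    ∃ C : Set G, IsCompact C ∧
      Subgroup.closure C = MulAction.stabilizer G (T.origin e₀) := by
  set v := T.origin e₀ with hv
  obtain ⟨r, a, ha, hr⟩ := T.exists_orbit_representatives (G := G) hact v
  have hfin := hD.finite_image_smul_of_isOpen_stabilizer (hedge e₀).2
  have hpath : ∀ f : E, ∃ P : Set (E × E), P.Finite ∧ (∀ x ∈ P, T.origin x.1 = T.origin x.2) ∧
      ∃ p, T.IsWalk (fun a b => (a, b) ∈ P) p e₀ f := fun f => by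
    obtain ⟨p, hp⟩ := hT.connected v (T.origin f)
    obtain ⟨P, h1, h2, h3⟩ := hp.exists_finite_isWalk
    exact ⟨P, h1, h2, p, h3⟩
  choose P hPfin hPo hPw using hpath
  let Q : Set (E × E) := ⋃ f ∈ (fun g : G => g • e₀) '' D, P f
  have hQfin : Q.Finite := hfin.biUnion fun f _ => hPfin f
  -- For a turn at `g • v`, both factors come from elements carrying `v` to `g • v`, so `t x` fixes
  -- `v`.
  let t : E × E → G := fun x => (a x.1)⁻¹ * a x.2
  let C : Set G := (t '' {x ∈ Q | T.origin (r (Quotient.mk _ x.1)) = v}) ∪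
    ⋃ q ∈ {q | T.origin (r q) = v}, (MulAction.stabilizer G (r q) : Set G)
  have hC : IsCompact C :=
    ((hQfin.subset (Set.sep_subset _ _)).image t).isCompact.union
      ((Set.toFinite _).isCompact_biUnion fun q _ => (hedge (r q)).1)
  let H := Subgroup.closure C
  have hrH : ∀ q, T.origin (r q) = v → MulAction.stabilizer G (r q) ≤ H := fun q hq g hg =>
    Subgroup.subset_closure (Or.inr (Set.mem_biUnion (Set.mem_ofPred_eq ▸ hq) hg))
  have hoa : ∀ e, T.origin (r (Quotient.mk _ e)) = v → T.origin e = a e • v := fun e he => by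
    rw [← he, ← hact.origin_smul, ha]
  have hHv : H ≤ MulAction.stabilizer G v := by
    refine (Subgroup.closure_le _).2 ?_
    rintro g (⟨x, ⟨hxQ, hx⟩, rfl⟩ | hg)
    · obtain ⟨f, -, hf⟩ := Set.mem_iUnion₂.1 hxQ
      have h1 := hPo f x hf
      have h2 := hr x.2 (a x.1) (h1 ▸ hoa _ hx)
      change ((a x.1)⁻¹ * a x.2) • v = v
      rw [mul_smul, ← hoa _ h2, ← h1, hoa _ hx, inv_smul_smul]
    · obtain ⟨q, hq, hg⟩ := Set.mem_iUnion₂.1 hg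
      have hq' : T.origin (r q) = v := hq
      change g • v = v
      rw [← hq', ← hact.origin_smul, show g • r q = r q from hg]
  -- Vertices in the orbit of `v` are split by the coset `a e H`; all others stay whole.
  let R : E → E → Prop := fun e f => T.origin e = T.origin f ∧
    (T.origin (r (Quotient.mk _ e)) = v → (a e)⁻¹ * a f ∈ H)
  have hrr : ∀ e f, T.origin e = T.origin f → T.origin (r (Quotient.mk _ e)) = v →
      T.origin (r (Quotient.mk _ f)) = v := fun e f h he => hr f (a e) (h ▸ hoa e he)
  have hR : Equivalence R := by
    refine ⟨fun e => ⟨rfl, fun _ => by simp⟩, fun {e f} h => ⟨h.1.symm, fun hf => ?_⟩,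
      fun {e f g} h h' => ⟨h.1.trans h'.1, fun he => ?_⟩⟩
    · simpa using H.inv_mem (h.2 (hrr f e h.1.symm hf))
    · simpa [mul_assoc] using H.mul_mem (h.2 he) (h'.2 (hrr e f h.1 he))
  have hmk : ∀ (g : G) e, (Quotient.mk _ (g • e) : MulAction.orbitRel.Quotient G E) =
      Quotient.mk _ e := fun g e => Quotient.sound ⟨g, rfl⟩
  -- `g * a e` and `a (g • e)` send the same representative to `g • e`, hence differ by its
  -- stabilizer. This makes `R` invariant.
  have hag : ∀ (g : G) e, T.origin (r (Quotient.mk _ e)) = v → (g * a e)⁻¹ * a (g • e) ∈ H := by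
    intro g e he
    refine hrH _ he ?_
    rw [MulAction.mem_stabilizer_iff, mul_smul, inv_smul_eq_iff, mul_smul, ha]
    conv_lhs => rw [← hmk g e]
    exact ha _
  have hRsmul : ∀ (g : G) e f, R e f → R (g • e) (g • f) := by
    intro g e f h
    refine ⟨by rw [hact.origin_smul, hact.origin_smul, h.1], fun he => ?_⟩
    rw [hmk] at he
    have := H.mul_mem (H.mul_mem (H.inv_mem (hag g e he)) (h.2 he)) (hag g f (hrr e f h.1 he))
    simpa [mul_assoc] using this
  have hconn : ∀ g : G, ∃ p, T.IsWalk R p e₀ (g • e₀) := by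
    intro g
    have hg : g ∈ Subgroup.closure D := hDG ▸ Subgroup.mem_top g
    induction hg using Subgroup.closure_induction with
    | mem s hs =>
      obtain ⟨p, hp⟩ := hPw (s • e₀)
      refine ⟨p, hp.mono fun e f hef => ⟨hPo _ _ hef, fun he => Subgroup.subset_closure ?_⟩⟩
      exact Or.inl ⟨(e, f), ⟨Set.mem_biUnion (Set.mem_image_of_mem _ hs) hef, he⟩, rfl⟩
    | one => exact ⟨[], by simpa [IsWalk] using hR.refl e₀⟩
    | mul x y _ _ hx hy =>
      obtain ⟨p, hp⟩ := hx
      obtain ⟨q, hq⟩ := hy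
      rw [mul_smul]
      exact ⟨_, hp.append hR (hq.smul hact hRsmul x)⟩
    | inv x _ hx =>
      obtain ⟨p, hp⟩ := hx
      obtain ⟨q, hq⟩ := (hp.smul hact hRsmul x⁻¹).exists_symm hR
      exact ⟨q, by simpa using hq⟩
  refine ⟨C, hC, le_antisymm hHv fun g hg => ?_⟩
  have hr₀ : T.origin (r (Quotient.mk _ e₀)) = v := hr e₀ 1 (by rw [one_smul])
  have ha₀ : a e₀ • v = v := (hoa e₀ hr₀).symm
  -- Conjugating by `a e₀` offsets the base coset `a e₀ H`, so that `g` itself lands in `H`.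
  obtain ⟨p, hp⟩ := hconn (a e₀ * g * (a e₀)⁻¹)
  have hfix : (a e₀ * g * (a e₀)⁻¹) • v = v := by
    rw [mul_smul, mul_smul, inv_smul_eq_iff.2 ha₀.symm, show g • v = v from hg, ha₀]
  have h := (hp.rel_of_origin_eq hT.no_circuit hR (fun _ _ h => h.1)
    (by rw [hact.origin_smul, ← hv, hfix])).2 hr₀
  have := H.mul_mem h (H.inv_mem (hag (a e₀ * g * (a e₀)⁻¹) e₀ hr₀))
  simpa [mul_assoc] using this

end SerreGraph

theorem proposition4p1 {G : Type*} [Group G] [TopologicalSpace G] [IsTopologicalGroup G]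
    [LocallyCompactSpace G] [TotallyDisconnectedSpace G]
    (hG : IsCompactlyGeneratedGroup G)
    {V E : Type*} [MulAction G V] [MulAction G E]
    (T : SerreGraph V E) (hT : T.IsTree)
    (hact : T.IsAction G) (hdisc : T.ActsDiscretely G)
    (hinv : T.WithoutInversions G)
    (hfin : (T.quotient G hact hinv).IsFinite)
    (hedge : ∀ e : E, IsCompact (MulAction.stabilizer G e : Set G) ∧
      IsOpen (MulAction.stabilizer G e : Set G)) :
    ∀ v : V, IsCompactlyGeneratedGroup (MulAction.stabilizer G v) := by
  intro v
  obtain ⟨K, S, hKc, hKo, hS, -, -, hgen⟩ := hG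
  have hD : IsCompact (S ∪ (K : Set G)) := hS.isCompact.union hKc
  have : Finite (MulAction.orbitRel.Quotient G E) := hfin.2
  by_cases h : ∃ e, T.origin e = v
  · obtain ⟨e, rfl⟩ := h
    obtain ⟨C, hC, hCv⟩ := hT.exists_isCompact_closure_eq_stabilizer hact hedge hD hgen e
    refine .of_isCompact_closure_eq hC hCv (fun g hg => ?_) (hedge e).1 (hedge e).2
    rw [MulAction.mem_stabilizer_iff] at hg ⊢
    rw [← hact.origin_smul, hg]
  -- With no edge at `v`, connectedness leaves `v` as the only vertex.
  · have hfix : MulAction.stabilizer G v = ⊤ := by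
      refine eq_top_iff.2 fun g _ => ?_
      obtain ⟨p, hp⟩ := hT.connected v (g • v)
      cases p with
      | nil => exact hp.symm
      | cons x p => exact (h ⟨x, hp.1⟩).elim
    rw [hfix]
    exact .of_isCompact_closure_eq hD hgen le_top hKc hKo
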